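/- Let $H$ be a complex Hilbert space, with inner product $\langle\cdot,\cdot\rangle$ linear in the second variable, and let $|x\rangle\langle y|$ denote the operator $z\mapsto\langle y,z\rangle x$. Let $(T_t)_{t\ge 0}$ be a quantum Markov semigroup on $B(H)$: each $T_t:B(H)\to B(H)$ is linear, completely positive and $\sigma$-weakly continuous, $T_0=\mathrm{id}$, $T_{t+s}=T_tT_s$, $T_t(1)=1$, and $t\mapsto T_t(A)$ is $\sigma$-weakly continuous for every $A\in B(H)$. Let $L$ be its generator: $D(L)$ is the set of $A\in B(H)$ for which $\frac1t(T_tA-A)$ converges $\sigma$-weakly as $t\to0^+$, and $L(A)$ is this limit. For linear subspaces $W\subseteq H$ and $\mathcal A\subseteq B(H)$, a linear map $\phi$ from $\mathcal A$ to the sesquilinear forms on $W\times W$ (conjugate linear in the first variable) is called $W$-completely positive if $\sum_{i,j=1}^k\phi(A_{ij})(u_i,u_j)\ge0$ for all $k$, all matrices $(A_{ij})\in M_k(\mathcal A)$ that are positive in $M_k(B(H))$, and all $u_1,\dots,u_k\in W$. **Theorem 3.6.** There are a linear (not necessarily closed) subspace $W$ of $H$, a $W$-completely positive map $\phi$ from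 $D(L)$ to the sesquilinear forms on $W\times W$, and a linear operator $K:W\to H$ such that $$\langle u,L(A)v\rangle=\phi(A)(u,v)+\langle Ku,Av\rangle+\langle u,AKv\rangle\qquad\text{for all }A\in D(L),\ u,v\in W.\tag{1}$$ More precisely, $W$ and $K$ can be taken as follows. For every $\varepsilon>0$ the map $1-\varepsilon L:D(L)\to B(H)$ is bijective and $L_\varepsilon=L(1-\varepsilon L)^{-1}$ is a bounded operator on $B(H)$. Let $T=\sum_{s=1}^m t_s|k_s\rangle\langle k_s|$ be a nonzero positive finite rank operator, with $k_1,\dots,k_m$ orthonormal and $t_s>0$, and let $h=(\sum_s t_s)^{-1/2}\sum_s k_s$. For $\varepsilon>0$ the formula $$G_\varepsilon x=L_\varepsilon\big(|x\rangle\langle Th|\big)h-\tfrac12\langle h,L_\varepsilon(T)h\rangle x$$ defines $G_\varepsilon\in B(H)$. Put $$W=\{u\in H:\ \lim_{\varepsilon\to0^+}\langle g,G_\varepsilon^*u\rangle\text{ exists for all }g\in H\}.$$ Then $W$ is a linear subspace, for each $u\in W$ the weak limit $Ku=\text{weak-}\lim_{\varepsilon\to0^+}G_\varepsilon^*u$ exists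 and defines a linear operator $K:W\to H$, and for this $W$ and this $K$ there is a $W$-completely positive map $\phi$ on $D(L)$ satisfying (1). -/

import Mathlib

open scoped ComplexOrder InnerProductSpace NNReal Topology CStarAlgebra
open Filter

noncomputable section

/-- A pair of square-summable sequences of vectors of `H`. Such a pair `(x, y)` represents the
trace-class operator `∑ₙ |yₙ⟩⟨xₙ|`, and every trace-class operator is of this form. -/
structure SquareSummablePair (H : Type*) [NormedAddCommGroup H] where
  left : ℕ → H
  right : ℕ → H
  summable_left : Summable fun n => ‖left n‖ ^ 2
  summable_right : Summable fun n => ‖right n‖ ^ 2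

section

variable {H : Type*} [NormedAddCommGroup H] [InnerProductSpace ℂ H]

/-- The functional `A ↦ ∑ₙ ⟨xₙ, A yₙ⟩ = tr (A ∑ₙ |yₙ⟩⟨xₙ|)` on `B(H)`; the series converges
absolutely. -/
def SquareSummablePair.functional (p : SquareSummablePair H) (A : H →L[ℂ] H) : ℂ :=
  ∑' n, ⟪p.left n, A (p.right n)⟫_ℂ

theorem SquareSummablePair.summable (p : SquareSummablePair H) (A : H →L[ℂ] H) :
    Summable fun n => ⟪p.left n, A (p.right n)⟫_ℂ := by
  refine Summable.of_norm_bounded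
    (g := fun n => ‖A‖ * (‖p.left n‖ ^ 2 + ‖p.right n‖ ^ 2))
    ((p.summable_left.add p.summable_right).mul_left _) fun n => ?_
  calc ‖⟪p.left n, A (p.right n)⟫_ℂ‖ ≤ ‖p.left n‖ * ‖A (p.right n)‖ := norm_inner_le_norm _ _
    _ ≤ ‖p.left n‖ * (‖A‖ * ‖p.right n‖) := by gcongr; exact A.le_opNorm _
    _ = ‖A‖ * (‖p.left n‖ * ‖p.right n‖) := by ring
    _ ≤ ‖A‖ * (‖p.left n‖ ^ 2 + ‖p.right n‖ ^ 2) := by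
        gcongr
        nlinarith [sq_nonneg (‖p.left n‖ - ‖p.right n‖), sq_nonneg ‖p.left n‖,
          sq_nonneg ‖p.right n‖]

theorem SquareSummablePair.functional_add (p : SquareSummablePair H) (A B : H →L[ℂ] H) :
    p.functional (A + B) = p.functional A + p.functional B := by
  simp only [functional, add_apply, inner_add_right]
  exact (p.summable A).tsum_add (p.summable B)

theorem SquareSummablePair.functional_smul (p : SquareSummablePair H) (c : ℂ) (A : H →L[ℂ] H) :
    p.functional (c • A) = c * p.functional A := by
  simp only [functional, smul_apply, inner_smul_right, tsum_mul_left]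

/-- The rank-one pair, whose functional is `A ↦ ⟨x, A y⟩`. -/
def SquareSummablePair.single (x y : H) : SquareSummablePair H where
  left := Pi.single 0 x
  right := Pi.single 0 y
  summable_left := summable_of_ne_finset_zero (s := {0}) fun n hn => by
    simp [Pi.single_eq_of_ne (by simpa using hn : n ≠ 0)]
  summable_right := summable_of_ne_finset_zero (s := {0}) fun n hn => by
    simp [Pi.single_eq_of_ne (by simpa using hn : n ≠ 0)]

theorem SquareSummablePair.functional_single (x y : H) (A : H →L[ℂ] H) :
    (SquareSummablePair.single x y).functional A = ⟪x, A y⟫_ℂ := by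
  rw [functional, tsum_eq_single 0]
  · simp [single]
  · intro n hn
    simp [single, Pi.single_eq_of_ne hn]

end

/-- The σ-weak (ultraweak) topology on `B(H)`: the coarsest topology for which all the
functionals `A ↦ ∑ₙ ⟨xₙ, A yₙ⟩` with `∑ₙ ‖xₙ‖² < ∞` and `∑ₙ ‖yₙ‖² < ∞` are continuous. -/
@[reducible]
def sigmaWeak (H : Type*) [NormedAddCommGroup H] [InnerProductSpace ℂ H] :
    TopologicalSpace (H →L[ℂ] H) :=
  TopologicalSpace.induced
    (fun (A : H →L[ℂ] H) (p : SquareSummablePair H) => p.functional A) inferInstance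

section

variable {H : Type*} [NormedAddCommGroup H] [InnerProductSpace ℂ H]

theorem tendsto_sigmaWeak_iff {ι : Type*} {l : Filter ι} {F : ι → H →L[ℂ] H} {A : H →L[ℂ] H} :
    Tendsto F l (@nhds _ (sigmaWeak H) A) ↔
      ∀ p : SquareSummablePair H, Tendsto (fun i => p.functional (F i)) l (𝓝 (p.functional A)) := by
  rw [sigmaWeak, nhds_induced, tendsto_comap_iff, tendsto_pi_nhds]
  rfl

theorem sigmaWeak_limit_unique {ι : Type*} {l : Filter ι} [l.NeBot] {F : ι → H →L[ℂ] H}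
    {A B : H →L[ℂ] H} (hA : Tendsto F l (@nhds _ (sigmaWeak H) A))
    (hB : Tendsto F l (@nhds _ (sigmaWeak H) B)) : A = B := by
  rw [tendsto_sigmaWeak_iff] at hA hB
  ext y
  refine ext_inner_left ℂ fun x => ?_
  simpa only [SquareSummablePair.functional_single] using
    tendsto_nhds_unique (hA (.single x y)) (hB (.single x y))

end

/-- A quantum Markov semigroup on `B(H)`. -/
structure QuantumMarkovSemigroup (H : Type*) [NormedAddCommGroup H] [InnerProductSpace ℂ H]
    [CompleteSpace H] where
  /-- The completely positive linear maps `T_t : B(H) → B(H)`, `t ≥ 0`. -/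
  T : ℝ≥0 → (H →L[ℂ] H) →CP (H →L[ℂ] H)
  continuous_map : ∀ t, @Continuous _ _ (sigmaWeak H) (sigmaWeak H) (T t)
  map_zero : ∀ A, T 0 A = A
  map_add : ∀ t s A, T (t + s) A = T t (T s A)
  continuous_orbit : ∀ A, @Continuous _ _ inferInstance (sigmaWeak H) fun t => T t A
  map_one : ∀ t, T t 1 = 1

namespace QuantumMarkovSemigroup

variable {H : Type*} [NormedAddCommGroup H] [InnerProductSpace ℂ H] [CompleteSpace H]

/-- The difference quotient `(T_t A - A) / t`. -/
def quotient (S : QuantumMarkovSemigroup H) (A : H →L[ℂ] H) (t : ℝ≥0) : H →L[ℂ] H :=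
  ((t : ℝ) : ℂ)⁻¹ • (S.T t A - A)

/-- `A` is in the domain of the generator, with value `B` there: `(T_t A - A) / t → B` σ-weakly
as `t → 0⁺`. -/
def GeneratesAt (S : QuantumMarkovSemigroup H) (A B : H →L[ℂ] H) : Prop :=
  Tendsto (S.quotient A) (𝓝[>] 0) (@nhds _ (sigmaWeak H) B)

theorem GeneratesAt.unique {S : QuantumMarkovSemigroup H} {A B C : H →L[ℂ] H}
    (hB : S.GeneratesAt A B) (hC : S.GeneratesAt A C) : B = C :=
  sigmaWeak_limit_unique hB hC

theorem GeneratesAt.add {S : QuantumMarkovSemigroup H} {A A' B B' : H →L[ℂ] H}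
    (h : S.GeneratesAt A B) (h' : S.GeneratesAt A' B') : S.GeneratesAt (A + A') (B + B') := by
  unfold GeneratesAt at *
  rw [tendsto_sigmaWeak_iff] at *
  intro p
  rw [p.functional_add]
  refine ((h p).add (h' p)).congr fun t => ?_
  rw [← p.functional_add]
  congr 1
  simp only [quotient, _root_.map_add, ← smul_add]
  congr 1
  abel

theorem GeneratesAt.smul {S : QuantumMarkovSemigroup H} {A B : H →L[ℂ] H} (c : ℂ)
    (h : S.GeneratesAt A B) : S.GeneratesAt (c • A) (c • B) := by
  unfold GeneratesAt at *
  rw [tendsto_sigmaWeak_iff] at *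
  intro p
  rw [p.functional_smul]
  refine ((h p).const_mul c).congr fun t => ?_
  rw [← p.functional_smul]
  congr 1
  simp only [quotient, map_smul, ← smul_sub, smul_comm c]

/-- The domain `D(L)`: all `A` for which `(T_t A - A) / t` converges σ-weakly as `t → 0⁺`. -/
def domain (S : QuantumMarkovSemigroup H) : Submodule ℂ (H →L[ℂ] H) where
  carrier := {A | ∃ B, S.GeneratesAt A B}
  add_mem' := fun ⟨_, h⟩ ⟨_, h'⟩ => ⟨_, h.add h'⟩
  zero_mem' := ⟨0, by
    unfold GeneratesAt
    rw [tendsto_sigmaWeak_iff]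
    intro p
    simp [quotient]⟩
  smul_mem' := fun c _ ⟨_, h⟩ => ⟨_, h.smul c⟩

/-- The infinitesimal generator `L`: `L A` is the σ-weak limit of `(T_t A - A) / t` as
`t → 0⁺`, for `A ∈ D(L)`. -/
def generator (S : QuantumMarkovSemigroup H) : S.domain →ₗ[ℂ] (H →L[ℂ] H) where
  toFun A := A.2.choose
  map_add' A B := (A + B).2.choose_spec.unique (A.2.choose_spec.add B.2.choose_spec)
  map_smul' c A := (c • A).2.choose_spec.unique (A.2.choose_spec.smul c)

theorem generator_spec (S : QuantumMarkovSemigroup H) (A : S.domain) :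
    S.GeneratesAt A (S.generator A) :=
  A.2.choose_spec

end QuantumMarkovSemigroup

/-- Let `𝒜` be a linear subspace of `B(H)` and `U` a linear subspace of `H`. A linear map `φ` from
`𝒜` to the sesquilinear forms on `U × U` (conjugate linear in the first variable) is
`U`-completely positive if `∑ i j, φ(A i j)(u i, u j) ≥ 0` for every `k × k` matrix `A` with
entries in `𝒜` that is a positive element of `M_k(B(H))`, and all `u i ∈ U`. -/
def IsUCompletelyPositive {H : Type*} [NormedAddCommGroup H] [InnerProductSpace ℂ H]
    [CompleteSpace H] {𝒜 : Submodule ℂ (H →L[ℂ] H)} {U : Submodule ℂ H}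
    (φ : 𝒜 →ₗ[ℂ] (U →ₗ⋆[ℂ] U →ₗ[ℂ] ℂ)) : Prop :=
  ∀ (k : ℕ) (A : Matrix (Fin k) (Fin k) 𝒜),
    0 ≤ CStarMatrix.ofMatrix (A.map fun a => (a : H →L[ℂ] H)) →
      ∀ u : Fin k → U, 0 ≤ ∑ i, ∑ j, φ (A i j) (u i) (u j)

/-- `T` is a nonzero positive finite rank operator and `h` is an associate vector of it: for some
spectral decomposition `T = ∑ₛ tₛ |kₛ⟩⟨kₛ|` with `kₛ` orthonormal and `tₛ > 0`, one has
`h = (∑ₛ tₛ)^(-1/2) ∑ₛ kₛ`. (With `k'ₛ = √(tr T) kₛ` this is `h = ∑ₛ k'ₛ / ‖k'ₛ‖²`.) -/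
def IsAssociateVector {H : Type*} [NormedAddCommGroup H] [InnerProductSpace ℂ H]
    (T : H →L[ℂ] H) (h : H) : Prop :=
  T ≠ 0 ∧ ∃ (m : ℕ) (k : Fin m → H) (t : Fin m → ℝ), Orthonormal ℂ k ∧ (∀ s, 0 < t s) ∧
    T = ∑ s, (t s : ℂ) • InnerProductSpace.rankOne ℂ (k s) (k s) ∧
    h = ((√(∑ s, t s) : ℝ) : ℂ)⁻¹ • ∑ s, k s

/-- `Lε = L (1 - ε L)⁻¹`: the map `1 - ε L` is a bijection of `D(L)` onto `B(H)`, and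
`Lε ((1 - ε L) B) = L B` for all `B ∈ D(L)`. -/
def IsYosidaApproximation {H : Type*} [NormedAddCommGroup H] [InnerProductSpace ℂ H]
    {D : Submodule ℂ (H →L[ℂ] H)} (L : D →ₗ[ℂ] (H →L[ℂ] H)) (ε : ℝ)
    (Lε : (H →L[ℂ] H) →L[ℂ] (H →L[ℂ] H)) : Prop :=
  Function.Bijective (fun B : D => (B : H →L[ℂ] H) - (ε : ℂ) • L B) ∧
    ∀ B : D, Lε ((B : H →L[ℂ] H) - (ε : ℂ) • L B) = L B

end

/-! The resolvent `R_ε = ∫₀^∞ e⁻ˢ T_{εs} ds` inverts `1 - ε L` and inherits complete positivity from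
the semigroup. So `L_ε = ε⁻¹ (R_ε - 1)` is bounded, Hermitian and conditionally completely positive:
when `∑ B_i u_i = 0`, the subtracted identity contributes `ε⁻¹ ‖∑ B_i u_i‖² = 0`.

For such a map `Λ`, `A ↦ Λ A - G A - A G⋆` is completely positive
(`IsConditionallyCompletelyPositive.sum_sum_inner_nonneg`). The device is to adjoin to arbitrary
`B_i, u_i` one more vector, `h`, with an operator that forces the constraint; summing over the
spectral components of `T` leaves exactly this expression.

Finally let `ε → 0⁺`. On `D(L)` one has `L_ε A = R_ε (L A)`, which tends weakly to `L A`; on `W` the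
vectors `G_ε⋆ u` tend weakly to `K u`. With `A` fixed, weak convergence suffices for every term, and
inequalities survive. Since `φ` is defined as the difference of the other terms, (1) is automatic
and only positivity needs proof. -/

noncomputable section

/-! ### Laplace transforms of bounded continuous functions -/

section LaplaceTransform

open MeasureTheory Set

/-- The integrand `e⁻ˢ f(s)` of the Laplace transform of a bounded continuous function `f` is
integrable on `(0, ∞)`. -/
theorem integrableOn_exp_neg_mul_of_bounded {f : ℝ → ℂ} (hf : Continuous f) {C : ℝ}
    (hC : ∀ r, ‖f r‖ ≤ C) : IntegrableOn (fun s : ℝ => (Real.exp (-s) : ℂ) * f s) (Ioi 0) := by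
  refine Integrable.mono' ((integrableOn_exp_neg_Ioi 0).mul_const C) ?_ ?_
  · exact (by fun_prop : Continuous fun s : ℝ => (Real.exp (-s) : ℂ) * f s).aestronglyMeasurable
  · filter_upwards with s
    rw [norm_mul, Complex.norm_real, Real.norm_of_nonneg (Real.exp_pos _).le]
    exact mul_le_mul_of_nonneg_left (hC s) (Real.exp_pos _).le

theorem integral_Ioi_zero_comp_add_left (g : ℝ → ℂ) (t : ℝ) :
    ∫ s in Ioi (0 : ℝ), g (t + s) = ∫ s in Ioi t, g s := by
  have h := (measurePreserving_add_left volume t).setIntegral_preimage_emb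
    (MeasurableEquiv.addLeft t).measurableEmbedding g (Ioi t)
  simpa using h

/-- The substitution `r = t + ε s` gives `e^{t/ε} ε⁻¹ ∫_t^∞ e^{-r/ε} f(r) dr`, where `t` enters only
through a smooth factor and an endpoint; hence continuity of `f` is enough. -/
theorem hasDerivAt_integral_exp_neg_mul_comp_add {f : ℝ → ℂ} (hf : Continuous f) {C : ℝ}
    (hC : ∀ r, ‖f r‖ ≤ C) {ε : ℝ} (hε : 0 < ε) :
    HasDerivAt (fun t : ℝ => ∫ s in Ioi (0 : ℝ), (Real.exp (-s) : ℂ) * f (t + ε * s))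
      ((ε : ℂ)⁻¹ * ((∫ s in Ioi (0 : ℝ), (Real.exp (-s) : ℂ) * f (ε * s)) - f 0)) 0 := by
  set g : ℝ → ℂ := fun r => (Real.exp (-(ε⁻¹ * r)) : ℂ) * f r with hg
  have hgc : Continuous g := by fun_prop
  have hgi : IntegrableOn g (Ioi 0) := by
    have h := (exp_neg_integrableOn_Ioi 0 (inv_pos.2 hε)).mul_const C
    refine Integrable.mono' h hgc.aestronglyMeasurable ?_
    filter_upwards with s
    rw [norm_mul, Complex.norm_real, Real.norm_of_nonneg (Real.exp_pos _).le, neg_mul]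
    exact mul_le_mul_of_nonneg_left (hC s) (Real.exp_pos _).le
  have key : ∀ t : ℝ, ∫ s in Ioi (0 : ℝ), (Real.exp (-s) : ℂ) * f (t + ε * s) =
      (Real.exp (ε⁻¹ * t) : ℂ) * ((ε : ℂ)⁻¹ * ((∫ s in Ioi (0 : ℝ), g s) - ∫ s in (0 : ℝ)..t, g s)) := by
    intro t
    have h1 : ∀ s : ℝ, (Real.exp (-s) : ℂ) * f (t + ε * s) =
        (Real.exp (ε⁻¹ * t) : ℂ) * g (t + ε * s) := by
      intro s
      simp only [hg]
      rw [← mul_assoc, ← Complex.ofReal_mul, ← Real.exp_add]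
      congr 3
      field_simp
      ring
    simp_rw [h1]
    rw [integral_const_mul]
    have h2 := integral_comp_mul_left_Ioi (fun r => g (t + r)) 0 hε
    simp only [mul_zero] at h2
    rw [h2, integral_Ioi_zero_comp_add_left]
    -- The derivative at `0` is two-sided, so negative `t` occur as well.
    have hti : IntegrableOn g (Ioi t) := by
      rw [← integrableOn_Ici_iff_integrableOn_Ioi]
      rw [← integrableOn_Ici_iff_integrableOn_Ioi] at hgi
      rcases le_total t 0 with h | h
      · rw [← Icc_union_Ici_eq_Ici h]
        exact hgc.continuousOn.integrableOn_Icc.union hgi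
      · exact hgi.mono_set (Ici_subset_Ici.2 h)
    rw [← intervalIntegral.integral_interval_add_Ioi hgi hti, add_sub_cancel_left]
    simp [Complex.real_smul]
  have hF : (fun t : ℝ => ∫ s in Ioi (0 : ℝ), (Real.exp (-s) : ℂ) * f (t + ε * s)) =
      fun t : ℝ => (Real.exp (ε⁻¹ * t) : ℂ) *
        ((ε : ℂ)⁻¹ * ((∫ s in Ioi (0 : ℝ), g s) - ∫ s in (0 : ℝ)..t, g s)) := funext key
  have h0 := key 0
  simp only [zero_add] at h0
  rw [hF, h0]
  have hd1 : HasDerivAt (fun t : ℝ => (Real.exp (ε⁻¹ * t) : ℂ)) (ε⁻¹ : ℝ) 0 := by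
    have := ((hasDerivAt_id (0 : ℝ)).const_mul ε⁻¹).exp
    simpa using this.ofReal_comp
  have hd2 : HasDerivAt (fun t : ℝ => ∫ s in (0 : ℝ)..t, g s) (g 0) 0 :=
    intervalIntegral.integral_hasDerivAt_right (by simp)
      hgc.aestronglyMeasurable.stronglyMeasurableAtFilter hgc.continuousAt
  have hd := hd1.mul ((hd2.const_sub (∫ s in Ioi (0 : ℝ), g s)).const_mul (ε : ℂ)⁻¹)
  refine hd.congr_deriv ?_
  simp [hg]
  ring

theorem tendsto_integral_exp_neg_mul_comp_mul {f : ℝ → ℂ} (hf : Continuous f) {C : ℝ}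
    (hC : ∀ r, ‖f r‖ ≤ C) :
    Tendsto (fun ε : ℝ => ∫ s in Ioi (0 : ℝ), (Real.exp (-s) : ℂ) * f (ε * s)) (𝓝 0)
      (𝓝 (f 0)) := by
  have h0 : f 0 = ∫ s in Ioi (0 : ℝ), (Real.exp (-s) : ℂ) * f 0 := by
    rw [integral_mul_const, integral_complex_ofReal, integral_exp_neg_Ioi_zero]
    simp
  rw [h0]
  refine tendsto_integral_filter_of_dominated_convergence (fun s => Real.exp (-s) * C) ?_ ?_
    ((integrableOn_exp_neg_Ioi 0).mul_const C) ?_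
  · refine .of_forall fun ε => ?_
    exact (by fun_prop : Continuous fun s : ℝ => (Real.exp (-s) : ℂ) * f (ε * s)).aestronglyMeasurable
  · refine .of_forall fun ε => .of_forall fun s => ?_
    rw [norm_mul, Complex.norm_real, Real.norm_of_nonneg (Real.exp_pos _).le]
    exact mul_le_mul_of_nonneg_left (hC _) (Real.exp_pos _).le
  · refine .of_forall fun s => ?_
    have : Continuous fun ε : ℝ => (Real.exp (-s) : ℂ) * f (ε * s) := by fun_prop
    simpa using this.tendsto 0

end LaplaceTransform

/-! ### Functionals continuous for the `σ`-weak topology -/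

section

variable {H : Type*} [NormedAddCommGroup H] [InnerProductSpace ℂ H]

namespace SquareSummablePair

/-- The functional of a pair of square-summable sequences, as a linear map. -/
def functionalₗ (p : SquareSummablePair H) : (H →L[ℂ] H) →ₗ[ℂ] ℂ where
  toFun := p.functional
  map_add' := p.functional_add
  map_smul' := p.functional_smul

/-- An upper bound for the trace norm of the operator which a pair represents. -/
def bound (p : SquareSummablePair H) : ℝ := ∑' n, (‖p.left n‖ ^ 2 + ‖p.right n‖ ^ 2)

theorem norm_term_le (p : SquareSummablePair H) (A : H →L[ℂ] H) (n : ℕ) :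
    ‖⟪p.left n, A (p.right n)⟫_ℂ‖ ≤ ‖A‖ * (‖p.left n‖ ^ 2 + ‖p.right n‖ ^ 2) :=
  calc ‖⟪p.left n, A (p.right n)⟫_ℂ‖ ≤ ‖p.left n‖ * ‖A (p.right n)‖ := norm_inner_le_norm _ _
    _ ≤ ‖p.left n‖ * (‖A‖ * ‖p.right n‖) := by gcongr; exact A.le_opNorm _
    _ = ‖A‖ * (‖p.left n‖ * ‖p.right n‖) := by ring
    _ ≤ ‖A‖ * (‖p.left n‖ ^ 2 + ‖p.right n‖ ^ 2) := by
        gcongr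
        nlinarith [sq_nonneg (‖p.left n‖ - ‖p.right n‖), sq_nonneg ‖p.left n‖,
          sq_nonneg ‖p.right n‖]

theorem norm_functional_le (p : SquareSummablePair H) (A : H →L[ℂ] H) :
    ‖p.functional A‖ ≤ ‖A‖ * p.bound := by
  have h := (p.summable_left.add p.summable_right).mul_left ‖A‖
  rw [bound, ← tsum_mul_left]
  exact tsum_of_norm_bounded h.hasSum (p.norm_term_le A)

theorem continuous_functional (p : SquareSummablePair H) :
    @Continuous _ _ (sigmaWeak H) _ p.functional := by
  let := sigmaWeak H
  have h : Continuous fun (A : H →L[ℂ] H) (p : SquareSummablePair H) => p.functional A :=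
    continuous_induced_dom
  exact (continuous_pi_iff.1 h p :)

end SquareSummablePair

/-- The `σ`-weakly continuous linear functionals on `B(H)` are the linear combinations of the
functionals which define the `σ`-weak topology. -/
theorem mem_span_functionalₗ_of_continuous {φ : (H →L[ℂ] H) →ₗ[ℂ] ℂ}
    (hφ : @Continuous _ _ (sigmaWeak H) _ φ) :
    φ ∈ Submodule.span ℂ (Set.range (SquareSummablePair.functionalₗ (H := H))) := by
  rw [LinearMap.mem_span_iff_continuous]
  convert hφ
  rw [sigmaWeak, Pi.topologicalSpace, induced_iInf]
  simp only [induced_compose]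
  rfl

end

/-! ### Weak integrals of operators -/

section

open MeasureTheory

variable {H : Type*} [NormedAddCommGroup H] [InnerProductSpace ℂ H] [CompleteSpace H]

/-- The weak integral of a weakly continuous family of operators with an integrable norm bound. -/
theorem exists_weak_integral {f : ℝ → H →L[ℂ] H} {μ : Measure ℝ} {g : ℝ → ℝ} (hg : Integrable g μ)
    (hfg : ∀ s, ‖f s‖ ≤ g s) (hf : ∀ x y, Continuous fun s => ⟪x, f s y⟫_ℂ) :
    ∃ B : H →L[ℂ] H, ∀ p : SquareSummablePair H, p.functional B = ∫ s, p.functional (f s) ∂μ := by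
  have hle : ∀ x y s, ‖⟪x, f s y⟫_ℂ‖ ≤ g s * ‖x‖ * ‖y‖ := fun x y s =>
    calc ‖⟪x, f s y⟫_ℂ‖ ≤ ‖x‖ * ‖f s y‖ := norm_inner_le_norm _ _
      _ ≤ ‖x‖ * (g s * ‖y‖) := by gcongr; exact (f s).le_of_opNorm_le (hfg s) y
      _ = g s * ‖x‖ * ‖y‖ := by ring
  have hi : ∀ x y, Integrable (fun s => ⟪x, f s y⟫_ℂ) μ := fun x y =>
    Integrable.mono' ((hg.mul_const ‖x‖).mul_const ‖y‖) (hf x y).aestronglyMeasurable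
      (.of_forall (hle x y))
  let b : H →ₗ⋆[ℂ] H →ₗ[ℂ] ℂ := LinearMap.mk₂'ₛₗ (starRingEnd ℂ) (RingHom.id ℂ)
    (fun x y => ∫ s, ⟪x, f s y⟫_ℂ ∂μ)
    (fun x x' y => by simp only [inner_add_left]; exact integral_add (hi x y) (hi x' y))
    (fun c x y => by simp only [inner_smul_left]; exact integral_const_mul _ _)
    (fun x y y' => by
      simp only [map_add, inner_add_right]; exact integral_add (hi x y) (hi x y'))
    (fun c x y => by
      simp only [map_smul, inner_smul_right]; exact integral_const_mul _ _)
  have hb : ∀ x y, ‖b x y‖ ≤ (∫ s, g s ∂μ) * ‖x‖ * ‖y‖ := fun x y => by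
    have h := norm_integral_le_of_norm_le ((hg.mul_const ‖x‖).mul_const ‖y‖)
      (.of_forall (hle x y))
    rwa [integral_mul_const, integral_mul_const] at h
  -- The operator attached to `b` acts in the first slot of the inner product; its adjoint acts in
  -- the second.
  refine ⟨ContinuousLinearMap.adjoint
    (InnerProductSpace.continuousLinearMapOfBilin (b.mkContinuous₂ _ hb)), fun p => ?_⟩
  have hB : ∀ x y, ⟪x, ContinuousLinearMap.adjoint
      (InnerProductSpace.continuousLinearMapOfBilin (b.mkContinuous₂ _ hb)) y⟫_ℂ =
      ∫ s, ⟪x, f s y⟫_ℂ ∂μ := fun x y => by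
    rw [ContinuousLinearMap.adjoint_inner_right,
      InnerProductSpace.continuousLinearMapOfBilin_apply]
    rfl
  simp only [SquareSummablePair.functional, hB]
  -- From matrix elements to a general `p`: the sum and the integral commute, with `(∫ g) (‖xₙ‖² +
  -- ‖yₙ‖²)` as summable bound.
  refine (hasSum_integral_of_summable_integral_norm (fun n => hi _ _) ?_).tsum_eq
  have hs := (p.summable_left.add p.summable_right).mul_left (∫ s, g s ∂μ)
  refine Summable.of_nonneg_of_le (fun n => by positivity) (fun n => ?_) hs
  rw [← integral_mul_const]
  refine integral_mono (hi _ _).norm (hg.mul_const _) fun s => ?_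
  exact (p.norm_term_le (f s) n).trans (by gcongr; exact hfg s)

end

/-! ### Unital completely positive maps, resolvent and Yosida approximation -/

section

variable {H : Type*} [NormedAddCommGroup H] [InnerProductSpace ℂ H] [CompleteSpace H]

namespace CompletelyPositiveMap

theorem apply_nonneg (Φ : (H →L[ℂ] H) →CP (H →L[ℂ] H)) {A : H →L[ℂ] H} (hA : 0 ≤ A) :
    0 ≤ Φ A := by
  simpa using OrderHomClass.mono Φ hA

/-- Every operator is a combination of four positive ones, whose images are positive and hence
self-adjoint. -/
theorem apply_star (Φ : (H →L[ℂ] H) →CP (H →L[ℂ] H)) (A : H →L[ℂ] H) :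
    Φ (star A) = star (Φ A) := by
  obtain ⟨x, hx, -, rfl⟩ := CStarAlgebra.exists_sum_four_nonneg A
  simp only [star_sum, star_smul, map_sum, map_smul]
  refine Finset.sum_congr rfl fun i _ => ?_
  rw [(IsSelfAdjoint.of_nonneg (hx i)).star_eq,
    (IsSelfAdjoint.of_nonneg (Φ.apply_nonneg (hx i))).star_eq]

/-- A crude bound for the norm of a unital completely positive map. -/
theorem norm_apply_le_of_map_one (Φ : (H →L[ℂ] H) →CP (H →L[ℂ] H)) (hΦ : Φ 1 = 1)
    (A : H →L[ℂ] H) : ‖Φ A‖ ≤ 4 * ‖A‖ := by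
  obtain ⟨x, hx, hxA, hA⟩ := CStarAlgebra.exists_sum_four_nonneg A
  have h1 : ∀ i, ‖Φ (x i)‖ ≤ ‖A‖ := fun i => by
    have h := PositiveLinearMap.norm_apply_le_of_nonneg
      (.ofClass Φ : (H →L[ℂ] H) →ₚ[ℂ] (H →L[ℂ] H)) (x i) (hx i)
    have h' : ‖Φ (x i)‖ ≤ ‖Φ 1‖ * ‖x i‖ := h
    rw [hΦ] at h'
    calc ‖Φ (x i)‖ ≤ ‖(1 : H →L[ℂ] H)‖ * ‖x i‖ := h'
      _ ≤ 1 * ‖x i‖ := by gcongr; exact ContinuousLinearMap.norm_id_le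
      _ ≤ ‖A‖ := by simpa using hxA i
  calc ‖Φ A‖ = ‖∑ i : Fin 4, Complex.I ^ (i : ℕ) • Φ (x i)‖ := by
        conv_lhs => rw [hA]
        simp only [map_sum, map_smul]
    _ ≤ ∑ i : Fin 4, ‖Complex.I ^ (i : ℕ) • Φ (x i)‖ := norm_sum_le _ _
    _ ≤ ∑ _i : Fin 4, ‖A‖ := Finset.sum_le_sum fun i _ => by
        simpa [norm_smul] using h1 i
    _ = 4 * ‖A‖ := by simp

end CompletelyPositiveMap

theorem tendsto_toReal_nhdsGT_zero :
    Tendsto (fun t : ℝ≥0 => (t : ℝ)) (𝓝[>] 0) (𝓝[>] 0) :=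
  tendsto_nhdsWithin_of_tendsto_nhds_of_eventually_within _
    ((NNReal.continuous_coe.tendsto 0).mono_left nhdsWithin_le_nhds)
    (eventually_nhdsWithin_of_forall fun t (ht : 0 < t) => NNReal.coe_pos.2 ht)

theorem tendsto_toNNReal_nhdsGT_zero :
    Tendsto Real.toNNReal (𝓝[>] 0) (𝓝[>] 0) :=
  tendsto_nhdsWithin_of_tendsto_nhds_of_eventually_within _
    (by simpa using (continuous_real_toNNReal.tendsto 0).mono_left nhdsWithin_le_nhds)
    (eventually_nhdsWithin_of_forall fun t (ht : 0 < t) => Real.toNNReal_pos.2 ht)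

namespace QuantumMarkovSemigroup

open MeasureTheory Set

variable (S : QuantumMarkovSemigroup H)

/-- Here `Real.toNNReal` extends the orbit to negative times by its value at `0`, so that calculus
on `ℝ` applies. -/
theorem continuous_functional_orbit (p : SquareSummablePair H) (A : H →L[ℂ] H) :
    Continuous fun r : ℝ => p.functional (S.T r.toNNReal A) := by
  have h := @Continuous.comp _ _ _ _ (sigmaWeak H) _ _ _ p.continuous_functional
    (S.continuous_orbit A)
  exact h.comp continuous_real_toNNReal

theorem norm_functional_orbit_le (p : SquareSummablePair H) (A : H →L[ℂ] H) (t : ℝ≥0) :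
    ‖p.functional (S.T t A)‖ ≤ 4 * ‖A‖ * p.bound :=
  (p.norm_functional_le _).trans <| mul_le_mul_of_nonneg_right
    ((S.T t).norm_apply_le_of_map_one (S.map_one t) A) (tsum_nonneg fun _ => by positivity)

theorem continuous_inner_orbit (A : H →L[ℂ] H) (x y : H) :
    Continuous fun r : ℝ => ⟪x, S.T r.toNNReal A y⟫_ℂ := by
  simpa only [SquareSummablePair.functional_single] using
    S.continuous_functional_orbit (.single x y) A

theorem exists_resolvent (ε : ℝ) : ∃ R : (H →L[ℂ] H) →L[ℂ] (H →L[ℂ] H),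
    ∀ (A : H →L[ℂ] H) (p : SquareSummablePair H), p.functional (R A) =
      ∫ s in Ioi (0 : ℝ), (Real.exp (-s) : ℂ) * p.functional (S.T (ε * s).toNNReal A) := by
  have h : ∀ A : H →L[ℂ] H, ∃ B : H →L[ℂ] H, ∀ p : SquareSummablePair H, p.functional B =
      ∫ s in Ioi (0 : ℝ), (Real.exp (-s) : ℂ) * p.functional (S.T (ε * s).toNNReal A) := fun A => by
    simp only [← SquareSummablePair.functional_smul]
    refine exists_weak_integral ((integrableOn_exp_neg_Ioi 0).mul_const (4 * ‖A‖))
      (fun s => ?_) fun x y => ?_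
    · rw [norm_smul, Complex.norm_real, Real.norm_of_nonneg (Real.exp_pos _).le]
      exact mul_le_mul_of_nonneg_left
        ((S.T _).norm_apply_le_of_map_one (S.map_one _) A) (Real.exp_pos _).le
    · simp only [smul_apply, inner_smul_right]
      have := (S.continuous_inner_orbit A x y).comp (continuous_const_mul ε)
      exact (by fun_prop : Continuous fun s : ℝ => (Real.exp (-s) : ℂ)).mul this
  choose R hR using h
  have hi : ∀ A x y, ⟪x, R A y⟫_ℂ =
      ∫ s in Ioi (0 : ℝ), (Real.exp (-s) : ℂ) * ⟪x, S.T (ε * s).toNNReal A y⟫_ℂ := fun A x y => by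
    simpa only [SquareSummablePair.functional_single] using hR A (.single x y)
  have hint : ∀ A x y, IntegrableOn
      (fun s : ℝ => (Real.exp (-s) : ℂ) * ⟪x, S.T (ε * s).toNNReal A y⟫_ℂ) (Ioi 0) :=
    fun A x y => by
      refine integrableOn_exp_neg_mul_of_bounded (C := 4 * ‖A‖ * (SquareSummablePair.single x y).bound)
        ((S.continuous_inner_orbit A x y).comp (continuous_const_mul ε)) fun r => ?_
      simpa only [SquareSummablePair.functional_single] using
        S.norm_functional_orbit_le (.single x y) A (ε * r).toNNReal
  let Rₗ : (H →L[ℂ] H) →ₗ[ℂ] (H →L[ℂ] H) :=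
    { toFun := R
      map_add' := fun A B => by
        ext y
        refine ext_inner_left ℂ fun x => ?_
        simp only [add_apply, inner_add_right, hi, _root_.map_add, mul_add]
        exact integral_add (hint A x y) (hint B x y)
      map_smul' := fun c A => by
        ext y
        refine ext_inner_left ℂ fun x => ?_
        simp only [smul_apply, inner_smul_right, hi, map_smul, RingHom.id_apply,
          ← integral_const_mul]
        refine integral_congr_ae (.of_forall fun s => ?_)
        simp only
        ring }
  refine ⟨Rₗ.mkContinuous 4 fun A => ?_, hR⟩
  refine ContinuousLinearMap.opNorm_le_bound _ (by positivity) fun y => ?_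
  have hn : ∀ x, ‖⟪x, R A y⟫_ℂ‖ ≤ 4 * ‖A‖ * (‖x‖ * ‖y‖) := fun x => by
    rw [hi]
    have h := norm_integral_le_of_norm_le (μ := volume.restrict (Ioi (0 : ℝ)))
      (f := fun s : ℝ => (Real.exp (-s) : ℂ) * ⟪x, S.T (ε * s).toNNReal A y⟫_ℂ)
      ((integrableOn_exp_neg_Ioi 0).mul_const (4 * ‖A‖ * (‖x‖ * ‖y‖))) (.of_forall fun s => ?_)
    · rwa [integral_mul_const, integral_exp_neg_Ioi_zero, one_mul] at h
    · rw [norm_mul, Complex.norm_real, Real.norm_of_nonneg (Real.exp_pos _).le]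
      refine mul_le_mul_of_nonneg_left ?_ (Real.exp_pos _).le
      calc ‖⟪x, S.T (ε * s).toNNReal A y⟫_ℂ‖ ≤ ‖x‖ * ‖S.T (ε * s).toNNReal A y‖ :=
            norm_inner_le_norm _ _
        _ ≤ ‖x‖ * (4 * ‖A‖ * ‖y‖) := by
            gcongr
            exact ContinuousLinearMap.le_of_opNorm_le _
              ((S.T _).norm_apply_le_of_map_one (S.map_one _) A) y
        _ = 4 * ‖A‖ * (‖x‖ * ‖y‖) := by ring
  -- Testing against `x = R A y` bounds `‖R A y‖²`; one factor is then cancelled.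
  have h := hn (R A y)
  rw [inner_self_eq_norm_sq_to_K, norm_pow, RCLike.norm_ofReal, abs_norm, sq] at h
  change ‖R A y‖ ≤ 4 * ‖A‖ * ‖y‖
  rcases (norm_nonneg (R A y)).eq_or_lt with h0 | h0
  · rw [← h0]
    positivity
  · exact le_of_mul_le_mul_right (by linarith) h0

/-- The resolvent `(1 - ε L)⁻¹`, as the `σ`-weak integral `∫₀^∞ e⁻ˢ T_{εs} ds`. -/
def resolvent (ε : ℝ) : (H →L[ℂ] H) →L[ℂ] (H →L[ℂ] H) := (S.exists_resolvent ε).choose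

theorem functional_resolvent (ε : ℝ) (A : H →L[ℂ] H) (p : SquareSummablePair H) :
    p.functional (S.resolvent ε A) =
      ∫ s in Ioi (0 : ℝ), (Real.exp (-s) : ℂ) * p.functional (S.T (ε * s).toNNReal A) :=
  (S.exists_resolvent ε).choose_spec A p

theorem inner_resolvent (ε : ℝ) (A : H →L[ℂ] H) (x y : H) :
    ⟪x, S.resolvent ε A y⟫_ℂ =
      ∫ s in Ioi (0 : ℝ), (Real.exp (-s) : ℂ) * ⟪x, S.T (ε * s).toNNReal A y⟫_ℂ := by
  simpa only [SquareSummablePair.functional_single] using S.functional_resolvent ε A (.single x y)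

theorem integrableOn_functional_orbit (ε : ℝ) (A : H →L[ℂ] H) (p : SquareSummablePair H) :
    IntegrableOn (fun s : ℝ => (Real.exp (-s) : ℂ) * p.functional (S.T (ε * s).toNNReal A))
      (Ioi 0) :=
  integrableOn_exp_neg_mul_of_bounded
    ((S.continuous_functional_orbit p A).comp (continuous_const_mul ε))
    fun _ => S.norm_functional_orbit_le p A _

theorem resolvent_star (ε : ℝ) (A : H →L[ℂ] H) :
    S.resolvent ε (star A) = star (S.resolvent ε A) := by
  ext y
  refine ext_inner_left ℂ fun x => ?_
  rw [ContinuousLinearMap.star_eq_adjoint (S.resolvent ε A),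
    ContinuousLinearMap.adjoint_inner_right, ← inner_conj_symm (S.resolvent ε A x), inner_resolvent,
    inner_resolvent, ← integral_conj]
  refine integral_congr_ae (.of_forall fun s => ?_)
  beta_reduce
  rw [CompletelyPositiveMap.apply_star, map_mul, Complex.conj_ofReal, inner_conj_symm,
    ContinuousLinearMap.star_eq_adjoint, ContinuousLinearMap.adjoint_inner_right]

theorem tendsto_inner_resolvent (A : H →L[ℂ] H) (x y : H) :
    Tendsto (fun ε => ⟪x, S.resolvent ε A y⟫_ℂ) (𝓝[>] 0) (𝓝 ⟪x, A y⟫_ℂ) := by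
  simp only [← SquareSummablePair.functional_single, functional_resolvent]
  have h := tendsto_integral_exp_neg_mul_comp_mul
    (S.continuous_functional_orbit (.single x y) A)
    (fun r => S.norm_functional_orbit_le (.single x y) A r.toNNReal)
  simp only [Real.toNNReal_zero, S.map_zero] at h
  exact h.mono_left nhdsWithin_le_nhds

/-- `T_t` passes under the integral because `p ∘ T_t` is again `σ`-weakly continuous, hence a finite
combination of functionals for which the integral formula is known. -/
theorem functional_T_resolvent (ε : ℝ) (t : ℝ≥0) (A : H →L[ℂ] H)
    (p : SquareSummablePair H) :
    p.functional (S.T t (S.resolvent ε A)) =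
      ∫ s in Ioi (0 : ℝ), (Real.exp (-s) : ℂ) * p.functional (S.T t (S.T (ε * s).toNNReal A)) := by
  let φ : (H →L[ℂ] H) →ₗ[ℂ] ℂ := p.functionalₗ ∘ₗ (S.T t).toLinearMap
  have hc : @Continuous _ _ (sigmaWeak H) _ φ := by
    let := sigmaWeak H
    exact (p.continuous_functional.comp (S.continuous_map t) :)
  have hφ := mem_span_functionalₗ_of_continuous hc
  -- Integrability is carried through the induction, since additivity of the integral requires it.
  suffices h : IntegrableOn (fun s : ℝ => (Real.exp (-s) : ℂ) * φ (S.T (ε * s).toNNReal A)) (Ioi 0) ∧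
      φ (S.resolvent ε A) = ∫ s in Ioi (0 : ℝ), (Real.exp (-s) : ℂ) * φ (S.T (ε * s).toNNReal A) from
    h.2
  clear_value φ
  clear hc
  induction hφ using Submodule.span_induction with
  | mem ψ hψ =>
    obtain ⟨q, rfl⟩ := hψ
    exact ⟨S.integrableOn_functional_orbit ε A q, S.functional_resolvent ε A q⟩
  | zero => simp
  | add ψ χ _ _ hψ hχ =>
    simp only [LinearMap.add_apply, mul_add]
    exact ⟨hψ.1.add hχ.1, by rw [hψ.2, hχ.2]; exact (integral_add hψ.1 hχ.1).symm⟩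
  | smul c ψ _ hψ =>
    simp only [LinearMap.smul_apply, smul_eq_mul, mul_left_comm _ c]
    exact ⟨hψ.1.const_mul c, by rw [hψ.2]; exact (integral_const_mul _ _).symm⟩

/-- By the semigroup law `T_t R_ε A = ∫ e⁻ˢ T_{t+εs} A ds`, so the difference quotient is the slope
at `0` of a Laplace transform with shifted argument. -/
theorem generatesAt_resolvent {ε : ℝ} (hε : 0 < ε) (A : H →L[ℂ] H) :
    S.GeneratesAt (S.resolvent ε A) ((ε : ℂ)⁻¹ • (S.resolvent ε A - A)) := by
  unfold GeneratesAt
  rw [tendsto_sigmaWeak_iff]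
  intro p
  have hd := hasDerivAt_integral_exp_neg_mul_comp_add (S.continuous_functional_orbit p A)
    (fun r => S.norm_functional_orbit_le p A r.toNNReal) hε
  rw [hasDerivAt_iff_tendsto_slope_zero] at hd
  have hd' := (hd.mono_left (nhdsGT_le_nhdsNE 0)).comp tendsto_toReal_nhdsGT_zero
  have hlim : p.functional ((ε : ℂ)⁻¹ • (S.resolvent ε A - A)) = (ε : ℂ)⁻¹ *
      ((∫ s in Ioi (0 : ℝ), (Real.exp (-s) : ℂ) * p.functional (S.T (ε * s).toNNReal A)) -
        p.functional (S.T (0 : ℝ).toNNReal A)) := by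
    rw [p.functional_smul, ← functional_resolvent, Real.toNNReal_zero, S.map_zero]
    congr 1
    exact p.functionalₗ.map_sub _ _
  rw [hlim]
  refine hd'.congr fun t => ?_
  have h1 : p.functional (S.T t (S.resolvent ε A) - S.resolvent ε A) =
      p.functional (S.T t (S.resolvent ε A)) - p.functional (S.resolvent ε A) :=
    p.functionalₗ.map_sub _ _
  rw [quotient, p.functional_smul, h1, functional_T_resolvent, functional_resolvent]
  simp only [Function.comp_apply, zero_add, Complex.real_smul, Complex.ofReal_inv]
  congr 2
  refine setIntegral_congr_fun measurableSet_Ioi fun s hs => ?_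
  rw [Real.toNNReal_add t.coe_nonneg (mul_pos hε hs).le, Real.toNNReal_coe, S.map_add]

theorem generator_eq {A : S.domain} {B : H →L[ℂ] H} (h : S.GeneratesAt A B) :
    S.generator A = B :=
  (S.generator_spec A).unique h

/-- The resolvent with values in the domain of the generator. -/
def resolventDomain {ε : ℝ} (hε : 0 < ε) (A : H →L[ℂ] H) : S.domain :=
  ⟨S.resolvent ε A, _, S.generatesAt_resolvent hε A⟩

theorem sub_smul_generator_resolvent {ε : ℝ} (hε : 0 < ε) (A : H →L[ℂ] H) :
    (S.resolventDomain hε A : H →L[ℂ] H) - (ε : ℂ) • S.generator (S.resolventDomain hε A) = A := by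
  rw [S.generator_eq (A := S.resolventDomain hε A) (S.generatesAt_resolvent hε A), smul_smul,
    mul_inv_cancel₀ (Complex.ofReal_ne_zero.2 hε.ne'), one_smul]
  exact sub_sub_cancel _ _

/-- The generator has no positive eigenvalues. -/
theorem eq_zero_of_generatesAt_smul {c : ℝ} (hc : 0 < c) {A : H →L[ℂ] H}
    (h : S.GeneratesAt A ((c : ℂ) • A)) : A = 0 := by
  have hp : ∀ p : SquareSummablePair H, p.functional A = 0 := fun p => by
    -- The orbit solves `g' = c g`, so `e^{-cr} g(r)` is constant; as `g` is bounded it also tends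
    -- to `0`. Only right derivatives are available, and they suffice.
    set g : ℝ → ℂ := fun r => p.functional (S.T r.toNNReal A) with hg
    have hgc : Continuous g := S.continuous_functional_orbit p A
    have hg0 : g 0 = p.functional A := by simp [hg, S.map_zero]
    have hgd : ∀ r, 0 ≤ r → HasDerivWithinAt g (c * g r) (Ici r) r := fun r hr => by
      rw [← hasDerivWithinAt_Ioi_iff_Ici, hasDerivWithinAt_iff_tendsto_slope' (by simp)]
      have h1 : Tendsto (fun t => p.functional (S.T r.toNNReal (S.quotient A t))) (𝓝[>] 0)
          (𝓝 (p.functional (S.T r.toNNReal ((c : ℂ) • A)))) := by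
        let := sigmaWeak H
        exact ((p.continuous_functional.comp (S.continuous_map r.toNNReal)).tendsto _).comp h
      have h2 : Tendsto (fun x : ℝ => x - r) (𝓝[>] r) (𝓝[>] 0) := by
        refine tendsto_nhdsWithin_of_tendsto_nhds_of_eventually_within _ ?_
          (eventually_nhdsWithin_of_forall fun x (hx : r < x) => sub_pos.2 hx)
        have : Continuous fun x : ℝ => x - r := by fun_prop
        simpa using (this.tendsto r).mono_left nhdsWithin_le_nhds
      have h3 := (h1.comp tendsto_toNNReal_nhdsGT_zero).comp h2
      rw [map_smul, p.functional_smul] at h3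
      refine h3.congr' (eventually_nhdsWithin_of_forall fun x (hx : r < x) => ?_)
      have hxr : 0 ≤ x - r := (sub_pos.2 hx).le
      have hadd : x.toNNReal = r.toNNReal + (x - r).toNNReal := by
        rw [← Real.toNNReal_add hr hxr, add_sub_cancel]
      simp only [Function.comp_apply, quotient, map_smul, p.functional_smul, map_sub, slope_def_module,
        Real.coe_toNNReal _ hxr, Complex.real_smul, Complex.ofReal_inv, hg, hadd, S.map_add]
      congr 1
      exact p.functionalₗ.map_sub _ _
    have hconst : ∀ b, 0 ≤ b → (Real.exp (-(c * b)) : ℂ) * g b = g 0 := fun b hb => by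
      have hed : ∀ r : ℝ, HasDerivAt (fun r : ℝ => (Real.exp (-(c * r)) : ℂ))
          ((Real.exp (-(c * r)) * -c : ℝ) : ℂ) r := fun r => by
        have := (((hasDerivAt_id r).const_mul c).neg).exp
        simpa using this.ofReal_comp
      have := constant_of_has_deriv_right_zero (a := 0) (b := b)
        (f := fun r : ℝ => (Real.exp (-(c * r)) : ℂ) * g r) (by fun_prop) (fun r hr => ?_) b
        (right_mem_Icc.2 hb)
      · simpa using this
      · refine ((hed r).hasDerivWithinAt.mul (hgd r hr.1)).congr_deriv ?_
        push_cast
        ring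
    have hlim : Tendsto (fun b : ℝ => (Real.exp (-(c * b)) : ℂ) * g b) atTop (𝓝 0) := by
      refine squeeze_zero_norm (a := fun b => Real.exp (-(c * b)) * (4 * ‖A‖ * p.bound))
        (fun b => ?_) ?_
      · rw [norm_mul, Complex.norm_real, Real.norm_of_nonneg (Real.exp_pos _).le]
        exact mul_le_mul_of_nonneg_left (S.norm_functional_orbit_le p A _) (Real.exp_pos _).le
      · have := (Real.tendsto_exp_neg_atTop_nhds_zero.comp
          (tendsto_id.const_mul_atTop hc)).mul_const (4 * ‖A‖ * p.bound)
        simpa using this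
    rw [← hg0]
    refine tendsto_nhds_unique (tendsto_const_nhds.congr' ?_) hlim
    filter_upwards [eventually_ge_atTop 0] with b hb using (hconst b hb).symm
  ext y
  refine ext_inner_left ℂ fun x => ?_
  simpa only [SquareSummablePair.functional_single, zero_apply, inner_zero_right] using
    hp (.single x y)

/-- The resolvent is a right inverse, and a kernel element would satisfy `L B = ε⁻¹ B`. -/
theorem bijective_sub_smul_generator {ε : ℝ} (hε : 0 < ε) :
    Function.Bijective fun B : S.domain => (B : H →L[ℂ] H) - (ε : ℂ) • S.generator B := by
  have hε' : (ε : ℂ) ≠ 0 := Complex.ofReal_ne_zero.2 hε.ne'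
  refine ⟨?_, fun A => ⟨S.resolventDomain hε A, S.sub_smul_generator_resolvent hε A⟩⟩
  let f : S.domain →ₗ[ℂ] (H →L[ℂ] H) := S.domain.subtype - (ε : ℂ) • S.generator
  change Function.Injective f
  refine (injective_iff_map_eq_zero f).2 fun B hB => ?_
  have h1 : (B : H →L[ℂ] H) = (ε : ℂ) • S.generator B := sub_eq_zero.1 hB
  have h2 : S.generator B = ((ε⁻¹ : ℝ) : ℂ) • (B : H →L[ℂ] H) := by
    conv_rhs => rw [h1]
    rw [smul_smul, Complex.ofReal_inv, inv_mul_cancel₀ hε', one_smul]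
  refine Subtype.ext (S.eq_zero_of_generatesAt_smul (inv_pos.2 hε) ?_)
  rw [← h2]
  exact S.generator_spec B

theorem resolvent_sub_smul_generator {ε : ℝ} (hε : 0 < ε) (B : S.domain) :
    S.resolvent ε ((B : H →L[ℂ] H) - (ε : ℂ) • S.generator B) = B :=
  congrArg Subtype.val <| (S.bijective_sub_smul_generator hε).1 <|
    S.sub_smul_generator_resolvent hε ((B : H →L[ℂ] H) - (ε : ℂ) • S.generator B)

/-- The Yosida approximation `L (1 - ε L)⁻¹ = ε⁻¹ ((1 - ε L)⁻¹ - 1)` of the generator. -/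
def yosida (ε : ℝ) : (H →L[ℂ] H) →L[ℂ] (H →L[ℂ] H) :=
  (ε : ℂ)⁻¹ • (S.resolvent ε - ContinuousLinearMap.id ℂ _)

theorem yosida_apply (ε : ℝ) (A : H →L[ℂ] H) :
    S.yosida ε A = (ε : ℂ)⁻¹ • (S.resolvent ε A - A) := rfl

theorem isYosidaApproximation_yosida {ε : ℝ} (hε : 0 < ε) :
    IsYosidaApproximation S.generator ε (S.yosida ε) := by
  refine ⟨S.bijective_sub_smul_generator hε, fun B => ?_⟩
  rw [yosida_apply, S.resolvent_sub_smul_generator hε, sub_sub_cancel, smul_smul,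
    inv_mul_cancel₀ (Complex.ofReal_ne_zero.2 hε.ne'), one_smul]

/-- This removes the singular factor `ε⁻¹`: as `ε → 0⁺` the resolvent acts on the fixed operator `L
A`. -/
theorem yosida_eq_resolvent_generator {ε : ℝ} (hε : 0 < ε) (A : S.domain) :
    S.yosida ε A = S.resolvent ε (S.generator A) := by
  have h := S.resolvent_sub_smul_generator hε A
  rw [map_sub, map_smul, sub_eq_iff_eq_add] at h
  rw [yosida_apply, h, add_sub_cancel_left, smul_smul,
    inv_mul_cancel₀ (Complex.ofReal_ne_zero.2 hε.ne'), one_smul]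

theorem yosida_star (ε : ℝ) (A : H →L[ℂ] H) : S.yosida ε (star A) = star (S.yosida ε A) := by
  simp [yosida_apply, resolvent_star]

theorem tendsto_inner_yosida (A : S.domain) (x y : H) :
    Tendsto (fun ε => ⟪x, S.yosida ε A y⟫_ℂ) (𝓝[>] 0) (𝓝 ⟪x, S.generator A y⟫_ℂ) :=
  (S.tendsto_inner_resolvent (S.generator A) x y).congr' <|
    eventually_nhdsWithin_of_forall fun ε (hε : 0 < ε) => by
      simp only [S.yosida_eq_resolvent_generator hε]

end QuantumMarkovSemigroup

end

/-! ### Positive operator matrices and conditional complete positivity -/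

section

open ContinuousLinearMap InnerProductSpace

variable {H : Type*} [NormedAddCommGroup H] [InnerProductSpace ℂ H] [CompleteSpace H]

theorem inner_star_mul_apply (A B : H →L[ℂ] H) (x y : H) :
    ⟪x, (star A * B) y⟫_ℂ = ⟪A x, B y⟫_ℂ := by
  rw [mul_apply_eq_comp, star_eq_adjoint, adjoint_inner_right]

theorem sum_sum_inner_star_mul_apply {k : ℕ} (B : Fin k → H →L[ℂ] H) (u : Fin k → H) :
    ∑ i, ∑ j, ⟪u i, (star (B i) * B j) (u j)⟫_ℂ = ⟪∑ i, B i (u i), ∑ i, B i (u i)⟫_ℂ := by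
  simp only [inner_star_mul_apply, sum_inner, inner_sum]
  exact Finset.sum_comm

theorem CStarAlgebra.exists_eq_star_mul_self_of_nonneg {A : Type*} [NonUnitalCStarAlgebra A]
    [PartialOrder A] [StarOrderedRing A] {a : A} (ha : 0 ≤ a) : ∃ b, a = star b * b :=
  CStarAlgebra.nonneg_iff_eq_star_mul_self.1 ha

/-- Splitting `N⋆ N` by the rows of `N` reduces positivity questions to matrices `(B_i⋆ B_j)`. -/
theorem CStarMatrix.exists_eq_sum_star_mul {k : ℕ} {M : CStarMatrix (Fin k) (Fin k) (H →L[ℂ] H)}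
    (hM : 0 ≤ M) : ∃ N : Fin k → Fin k → H →L[ℂ] H, ∀ i j, M i j = ∑ l, star (N l i) * N l j := by
  obtain ⟨N, rfl⟩ := CStarAlgebra.exists_eq_star_mul_self_of_nonneg hM
  exact ⟨N, fun i j => by simp [CStarMatrix.mul_apply, CStarMatrix.star_apply]⟩

/-- The matrix is `N⋆ N`, where the first row of the square matrix `N` is `B` and the others vanish.
For `k = 0` there is no first row. -/
theorem CStarMatrix.nonneg_star_mul {k : ℕ} (B : Fin k → H →L[ℂ] H) :
    0 ≤ (CStarMatrix.ofMatrix fun i j => star (B i) * B j :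
      CStarMatrix (Fin k) (Fin k) (H →L[ℂ] H)) := by
  rcases k with _ | k
  · exact le_of_eq (CStarMatrix.ext fun i => i.elim0)
  let N : CStarMatrix (Fin (k + 1)) (Fin (k + 1)) (H →L[ℂ] H) :=
    CStarMatrix.ofMatrix fun l i => if l = 0 then B i else 0
  have h : (CStarMatrix.ofMatrix fun i j => star (B i) * B j :
      CStarMatrix (Fin (k + 1)) (Fin (k + 1)) (H →L[ℂ] H)) = star N * N := by
    ext1 i j
    rw [CStarMatrix.mul_apply, Fin.sum_univ_succ]
    change star (B i) * B j = star (if (0 : Fin (k + 1)) = 0 then B i else 0) *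
      (if (0 : Fin (k + 1)) = 0 then B j else 0) + ∑ l : Fin k,
        star (if l.succ = 0 then B i else 0) * (if l.succ = 0 then B j else 0)
    simp
  rw [h]
  exact star_mul_self_nonneg N

theorem CompletelyPositiveMap.sum_sum_inner_nonneg (Φ : (H →L[ℂ] H) →CP (H →L[ℂ] H)) {k : ℕ}
    (B : Fin k → H →L[ℂ] H) (u : Fin k → H) :
    0 ≤ ∑ i, ∑ j, ⟪u i, Φ (star (B i) * B j) (u j)⟫_ℂ := by
  obtain ⟨N, hN⟩ := CStarMatrix.exists_eq_sum_star_mul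
    (Φ.map_cstarMatrix_nonneg _ (CStarMatrix.nonneg_star_mul B))
  have h : ∀ i j, Φ (star (B i) * B j) = ∑ l, star (N l i) * N l j := hN
  have h' : ∑ i, ∑ j, ⟪u i, Φ (star (B i) * B j) (u j)⟫_ℂ =
      ∑ l, ∑ i, ∑ j, ⟪u i, (star (N l i) * N l j) (u j)⟫_ℂ := by
    simp only [h, sum_apply, inner_sum]
    exact Finset.sum_comm_cycle
  rw [h']
  refine Finset.sum_nonneg fun l _ => ?_
  rw [sum_sum_inner_star_mul_apply]
  rw [inner_self_eq_norm_sq_to_K]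
  positivity

theorem integral_nonneg_complex {μ : MeasureTheory.Measure ℝ} {f : ℝ → ℂ} (hf : ∀ s, 0 ≤ f s) :
    0 ≤ ∫ s, f s ∂μ := MeasureTheory.integral_nonneg hf

/-- `Λ` is conditionally completely positive. -/
def IsConditionallyCompletelyPositive (Λ : (H →L[ℂ] H) →L[ℂ] (H →L[ℂ] H)) : Prop :=
  ∀ (k : ℕ) (B : Fin k → H →L[ℂ] H) (u : Fin k → H), ∑ i, B i (u i) = 0 →
    0 ≤ ∑ i, ∑ j, ⟪u i, Λ (star (B i) * B j) (u j)⟫_ℂ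

theorem QuantumMarkovSemigroup.sum_sum_inner_resolvent_nonneg (S : QuantumMarkovSemigroup H)
    (ε : ℝ) {k : ℕ} (B : Fin k → H →L[ℂ] H) (u : Fin k → H) :
    0 ≤ ∑ i, ∑ j, ⟪u i, S.resolvent ε (star (B i) * B j) (u j)⟫_ℂ := by
  have hi : ∀ i j, MeasureTheory.IntegrableOn (fun s : ℝ => (Real.exp (-s) : ℂ) *
      ⟪u i, S.T (ε * s).toNNReal (star (B i) * B j) (u j)⟫_ℂ) (Set.Ioi 0) := fun i j => by
    simpa only [SquareSummablePair.functional_single] using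
      S.integrableOn_functional_orbit ε (star (B i) * B j) (.single (u i) (u j))
  simp only [S.inner_resolvent]
  simp_rw [← MeasureTheory.integral_finsetSum _ fun j _ => hi _ j]
  rw [← MeasureTheory.integral_finsetSum _ fun i _ =>
    MeasureTheory.integrable_finsetSum _ fun j _ => hi i j]
  refine integral_nonneg_complex fun s => ?_
  simp only [← Finset.mul_sum]
  exact mul_nonneg (Complex.zero_le_real.2 (Real.exp_pos _).le)
    ((S.T _).sum_sum_inner_nonneg B u)

/-- The resolvent part is nonnegative without any constraint; the constraint kills the identity
part, which has the wrong sign. -/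
theorem QuantumMarkovSemigroup.isConditionallyCompletelyPositive_yosida
    (S : QuantumMarkovSemigroup H) {ε : ℝ} (hε : 0 < ε) :
    IsConditionallyCompletelyPositive (S.yosida ε) := fun k B u hu => by
  have h : ∑ i, ∑ j, ⟪u i, S.yosida ε (star (B i) * B j) (u j)⟫_ℂ =
      (ε : ℂ)⁻¹ * ∑ i, ∑ j, ⟪u i, S.resolvent ε (star (B i) * B j) (u j)⟫_ℂ -
        (ε : ℂ)⁻¹ * ∑ i, ∑ j, ⟪u i, (star (B i) * B j) (u j)⟫_ℂ := by
    simp only [S.yosida_apply, Finset.mul_sum, ← Finset.sum_sub_distrib, smul_apply, sub_apply,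
      inner_smul_right, inner_sub_right, mul_sub]
  rw [h, sum_sum_inner_star_mul_apply, hu, inner_zero_left, mul_zero, sub_zero,
    ← Complex.ofReal_inv]
  exact mul_nonneg (Complex.zero_le_real.2 (inv_pos.2 hε).le)
    (S.sum_sum_inner_resolvent_nonneg ε B u)

/-! ### Complete positivity of `Λ A - G A - A G⋆` -/

omit [CompleteSpace H] in
-- Take `a_s = √t_s k_s`; the scaling of `h` is what makes `∑ c_s² = 1`. The positivity argument
-- needs nothing else about `T` and `h`.
theorem IsAssociateVector.exists_decomposition {T : H →L[ℂ] H} {h : H}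
    (hT : IsAssociateVector T h) :
    ∃ (m : ℕ) (a : Fin m → H) (c : Fin m → ℝ), T = ∑ s, rankOne ℂ (a s) (a s) ∧
      (∀ s, ⟪a s, h⟫_ℂ = c s) ∧ ∑ s, c s ^ 2 = 1 := by
  obtain ⟨hT0, m, k, t, hk, ht, hTk, rfl⟩ := hT
  have hpos : 0 < ∑ s, t s := by
    refine Finset.sum_pos (fun s _ => ht s) ?_
    by_contra he
    rw [Finset.not_nonempty_iff_eq_empty] at he
    exact hT0 (by rw [hTk, he, Finset.sum_empty])
  refine ⟨m, fun s => ((√(t s) : ℝ) : ℂ) • k s, fun s => √(t s) / √(∑ s, t s), ?_, fun s => ?_, ?_⟩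
  · rw [hTk]
    refine Finset.sum_congr rfl fun s _ => ?_
    ext x
    simp only [smul_apply, rankOne_apply, inner_smul_left, Complex.conj_ofReal, smul_smul]
    congr 1
    rw [mul_right_comm, ← Complex.ofReal_mul, Real.mul_self_sqrt (ht s).le]
  · rw [inner_smul_left, inner_smul_right, inner_sum]
    simp [orthonormal_iff_ite.1 hk, div_eq_mul_inv]
  · simp only [div_pow, Real.sq_sqrt hpos.le, Real.sq_sqrt (ht _).le, ← Finset.sum_div]
    exact div_self hpos.ne'

/-- If `Λ` is conditionally completely positive and Hermitian and `h` is an associate vector of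
`T`, then `A ↦ Λ A - G A - A G⋆` is completely positive, where
`G x = Λ (|x⟩⟨T h|) h - ⟨h, Λ(T) h⟩ x / 2`. -/
theorem IsConditionallyCompletelyPositive.sum_sum_inner_nonneg
    {Λ : (H →L[ℂ] H) →L[ℂ] (H →L[ℂ] H)} (hΛ : IsConditionallyCompletelyPositive Λ)
    (hstar : ∀ A, Λ (star A) = star (Λ A)) {T : H →L[ℂ] H} {h : H} (hT : IsAssociateVector T h)
    {G : H →L[ℂ] H}
    (hG : ∀ x, G x = Λ (rankOne ℂ x (T h)) h - (2⁻¹ * ⟪h, Λ T h⟫_ℂ) • x) {k : ℕ}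
    (B : Fin k → H →L[ℂ] H) (u : Fin k → H) :
    0 ≤ ∑ i, ∑ j, ⟪u i, (Λ (star (B i) * B j) - G * (star (B i) * B j) -
      (star (B i) * B j) * star G) (u j)⟫_ℂ := by
  obtain ⟨m, a, c, hTa, hac, hc⟩ := hT.exists_decomposition
  set w := ∑ i, B i (u i) with hw
  set κ : ℂ := ⟪h, Λ T h⟫_ℂ with hκ
  have hTstar : star T = T := by
    rw [hTa]
    simp [star_eq_adjoint]
  -- `κ` is real because `T` is self-adjoint and `Λ` is Hermitian.
  have hκr : starRingEnd ℂ κ = κ := by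
    rw [hκ, inner_conj_symm, ← adjoint_inner_right, ← star_eq_adjoint, ← hstar, hTstar]
  have hTh : T h = ∑ s, (c s : ℂ) • a s := by
    rw [hTa]
    simp [sum_apply, hac]
  -- Index `0` carries `h` with the operator `-|w⟩⟨a_s|`, and the `B_j` are scaled by `c_s`. The
  -- constraint holds for each `s`, as `-⟨a_s, h⟩ w + c_s w = 0`.
  let v : Fin (k + 1) → H := Fin.cons h u
  let C : Fin m → Fin (k + 1) → H →L[ℂ] H := fun s =>
    Fin.cons (-rankOne ℂ w (a s)) fun j => (c s : ℂ) • B j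
  have hC : ∀ s, 0 ≤ ∑ i, ∑ j, ⟪v i, Λ (star (C s i) * C s j) (v j)⟫_ℂ := fun s => by
    refine hΛ _ _ _ ?_
    rw [Fin.sum_univ_succ]
    simp [C, v, hac, ← Finset.smul_sum, hw]
  -- Summed over `s`, the matrix has corner `⟨w, w⟩ T`, border `-|B_i⋆ w⟩⟨T h|` with its adjoint,
  -- and interior `B_i⋆ B_j` by `∑ c_s² = 1`.
  have hsum : ∀ i j, ∑ s, ⟪v i, Λ (star (C s i) * C s j) (v j)⟫_ℂ =
      ⟪v i, Λ (∑ s, star (C s i) * C s j) (v j)⟫_ℂ := fun i j => by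
    simp [sum_apply]
  have h00 : ∑ s, star (C s 0) * C s 0 = ⟪w, w⟫_ℂ • T := by
    ext x
    simp [C, hTa, star_eq_adjoint, sum_apply, Finset.smul_sum, smul_smul, mul_comm]
  have hi0 : ∀ i : Fin k, ∑ s, star (C s i.succ) * C s 0 = -rankOne ℂ (star (B i) w) (T h) :=
    fun i => by
      ext x
      simp [C, hTh, star_eq_adjoint, sum_apply, mul_smul]
  have h0i : ∀ i : Fin k, ∑ s, star (C s 0) * C s i.succ =
      star (-rankOne ℂ (star (B i) w) (T h)) := fun i => by
    rw [← hi0, star_sum]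
    simp
  have hij : ∀ i j : Fin k, ∑ s, star (C s i.succ) * C s j.succ = star (B i) * B j := fun i j => by
    have hc' : ∑ s, (c s : ℂ) * c s = 1 := by
      rw [← Complex.ofReal_one, ← hc, Complex.ofReal_sum]
      simp [sq]
    simp only [C, Fin.cons_succ, star_smul, Complex.star_def, Complex.conj_ofReal, smul_mul_smul,
      ← Finset.sum_smul, hc', one_smul]
  have htot : 0 ≤ ∑ i, ∑ j, ⟪v i, Λ (∑ s, star (C s i) * C s j) (v j)⟫_ℂ := by
    simp only [← hsum]
    rw [Finset.sum_comm_cycle]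
    exact Finset.sum_nonneg fun s _ => hC s
  set g : ℂ := ∑ i, ⟪u i, G (star (B i) w)⟫_ℂ with hg
  have hBw : ∑ i, ⟪u i, star (B i) w⟫_ℂ = ⟪w, w⟫_ℂ := by
    simp only [star_eq_adjoint, adjoint_inner_right]
    rw [← sum_inner, ← hw]
  have hi0' : ∑ i, ⟪u i, Λ (-rankOne ℂ (star (B i) w) (T h)) h⟫_ℂ =
      -(g + 2⁻¹ * κ * ⟪w, w⟫_ℂ) := by
    rw [hg, ← hBw, Finset.mul_sum, ← Finset.sum_add_distrib, ← Finset.sum_neg_distrib]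
    refine Finset.sum_congr rfl fun i _ => ?_
    rw [hG, inner_sub_right, inner_smul_right, sub_add_cancel]
    simp
  have h0i' : ∑ i, ⟪h, Λ (star (-rankOne ℂ (star (B i) w) (T h))) (u i)⟫_ℂ =
      -(starRingEnd ℂ g + 2⁻¹ * κ * ⟪w, w⟫_ℂ) := by
    have := congrArg (starRingEnd ℂ) hi0'
    rw [map_sum] at this
    simp only [map_neg, map_add, map_mul, inner_conj_symm, hκr] at this
    rw [Complex.conj_inv, Complex.conj_ofNat] at this
    rw [← this]
    refine Finset.sum_congr rfl fun i _ => ?_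
    rw [hstar, star_eq_adjoint (Λ _), adjoint_inner_right, map_neg]
  have hG1 : ∑ i, ∑ j, ⟪u i, (G * (star (B i) * B j)) (u j)⟫_ℂ = g := by
    rw [hg]
    refine Finset.sum_congr rfl fun i _ => ?_
    simp only [mul_apply_eq_comp, ← inner_sum, ← map_sum, hw]
  have hG2 : ∑ i, ∑ j, ⟪u i, ((star (B i) * B j) * star G) (u j)⟫_ℂ = starRingEnd ℂ g := by
    rw [← hG1, map_sum, Finset.sum_comm]
    simp only [map_sum, inner_conj_symm]
    refine Finset.sum_congr rfl fun i _ => Finset.sum_congr rfl fun j _ => ?_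
    simp only [mul_apply_eq_comp, star_eq_adjoint, adjoint_inner_right]
    rw [← adjoint_inner_left (B i), adjoint_inner_right]
  rw [Fin.sum_univ_succ] at htot
  simp only [Fin.sum_univ_succ (n := k), Finset.sum_add_distrib, h00, hi0, h0i, hij] at htot
  simp only [v, Fin.cons_zero, Fin.cons_succ] at htot
  rw [hi0', h0i', map_smul, smul_apply, inner_smul_right, ← hκ] at htot
  simp only [sub_apply, inner_sub_right, Finset.sum_sub_distrib, hG1, hG2]
  -- The corner gives `κ ⟨w, w⟩` and each border `-κ ⟨w, w⟩ / 2`, so these cancel; this explains the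
  -- scalar term in `G`.
  convert htot using 1
  ring

theorem IsConditionallyCompletelyPositive.sum_sum_inner_nonneg_of_nonneg
    {Λ : (H →L[ℂ] H) →L[ℂ] (H →L[ℂ] H)} (hΛ : IsConditionallyCompletelyPositive Λ)
    (hstar : ∀ A, Λ (star A) = star (Λ A)) {T : H →L[ℂ] H} {h : H} (hT : IsAssociateVector T h)
    {G : H →L[ℂ] H}
    (hG : ∀ x, G x = Λ (rankOne ℂ x (T h)) h - (2⁻¹ * ⟪h, Λ T h⟫_ℂ) • x) {k : ℕ}
    {M : CStarMatrix (Fin k) (Fin k) (H →L[ℂ] H)} (hM : 0 ≤ M) (u : Fin k → H) :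
    0 ≤ ∑ i, ∑ j, ⟪u i, (Λ (M i j) - G * M i j - M i j * star G) (u j)⟫_ℂ := by
  obtain ⟨N, hN⟩ := CStarMatrix.exists_eq_sum_star_mul hM
  have h' : ∑ i, ∑ j, ⟪u i, (Λ (M i j) - G * M i j - M i j * star G) (u j)⟫_ℂ =
      ∑ l, ∑ i, ∑ j, ⟪u i, (Λ (star (N l i) * N l j) - G * (star (N l i) * N l j) -
        (star (N l i) * N l j) * star G) (u j)⟫_ℂ := by
    simp only [hN, map_sum, Finset.mul_sum, Finset.sum_mul, ← Finset.sum_sub_distrib, sum_apply,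
      inner_sum]
    exact Finset.sum_comm_cycle
  rw [h']
  exact Finset.sum_nonneg fun l _ => hΛ.sum_sum_inner_nonneg hstar hT hG (N l) u

/-! ### Weak limits and the form `φ` -/

/-- A family of vectors whose inner products with all vectors converge has a weak limit. -/
theorem exists_weak_limit {ι : Type*} {l : Filter ι} [l.NeBot] [l.IsCountablyGenerated]
    {x : ι → H} (hx : ∀ g : H, ∃ c : ℂ, Tendsto (fun i => ⟪g, x i⟫_ℂ) l (𝓝 c)) :
    ∃ y : H, ∀ g : H, Tendsto (fun i => ⟪g, x i⟫_ℂ) l (𝓝 ⟪g, y⟫_ℂ) := by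
  choose c hc using hx
  have h : Tendsto (fun i g => innerSL ℂ (x i) g) l (𝓝 fun g => starRingEnd ℂ (c g)) := by
    refine tendsto_pi_nhds.2 fun g => ?_
    refine ((Complex.continuous_conj.tendsto _).comp (hc g)).congr fun i => ?_
    simp
  -- The uniform boundedness principle makes the pointwise limit a bounded functional, and Riesz
  -- represents it; conjugation makes the functionals linear in `g`.
  refine ⟨(toDual ℂ H).symm (continuousLinearMapOfTendsto (fun i => innerSL ℂ (x i)) h),
    fun g => ?_⟩
  rw [← inner_conj_symm, toDual_symm_apply]
  change Tendsto _ _ (𝓝 (starRingEnd ℂ (starRingEnd ℂ (c g))))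
  rw [Complex.conj_conj]
  exact hc g

/-- The subspace of the vectors `u` for which the weak limit of `F i u` exists. -/
def weakLimitDomain {ι : Type*} (l : Filter ι) (F : ι → H →L[ℂ] H) : Submodule ℂ H where
  carrier := {u | ∀ g : H, ∃ c : ℂ, Tendsto (fun i => ⟪g, F i u⟫_ℂ) l (𝓝 c)}
  add_mem' := fun {u v} hu hv g => by
    obtain ⟨c, hc⟩ := hu g
    obtain ⟨d, hd⟩ := hv g
    exact ⟨c + d, by simpa only [map_add, inner_add_right] using hc.add hd⟩
  zero_mem' := fun g => ⟨0, by simpa using tendsto_const_nhds⟩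
  smul_mem' := fun a u hu g => by
    obtain ⟨c, hc⟩ := hu g
    exact ⟨a * c, by simpa only [map_smul, inner_smul_right] using hc.const_mul a⟩

theorem exists_weakLimit_linearMap {ι : Type*} (l : Filter ι) [l.NeBot] [l.IsCountablyGenerated]
    (F : ι → H →L[ℂ] H) : ∃ K : weakLimitDomain l F →ₗ[ℂ] H,
      ∀ (u : weakLimitDomain l F) (g : H), Tendsto (fun i => ⟪g, F i u⟫_ℂ) l (𝓝 ⟪g, K u⟫_ℂ) := by
  have h : ∀ u : weakLimitDomain l F, ∃ y : H, ∀ g : H,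
      Tendsto (fun i => ⟪g, F i u⟫_ℂ) l (𝓝 ⟪g, y⟫_ℂ) := fun u => exists_weak_limit u.2
  choose K hK using h
  refine ⟨{ toFun := K, map_add' := fun u v => ?_, map_smul' := fun a u => ?_ }, hK⟩
  · refine ext_inner_left ℂ fun g => tendsto_nhds_unique (hK (u + v) g) ?_
    simpa only [Submodule.coe_add, map_add, inner_add_right] using (hK u g).add (hK v g)
  · refine ext_inner_left ℂ fun g => tendsto_nhds_unique (hK (a • u) g) ?_
    simpa only [Submodule.coe_smul, map_smul, inner_smul_right, RingHom.id_apply] using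
      (hK u g).const_mul a

/-- The sesquilinear forms `(u, v) ↦ ⟨u, L(A) v⟩ - ⟨K u, A v⟩ - ⟨u, A K v⟩`, linear in `A`. -/
def dissipationForm {𝒜 : Submodule ℂ (H →L[ℂ] H)} (L : 𝒜 →ₗ[ℂ] (H →L[ℂ] H)) {W : Submodule ℂ H}
    (K : W →ₗ[ℂ] H) : 𝒜 →ₗ[ℂ] (W →ₗ⋆[ℂ] W →ₗ[ℂ] ℂ) where
  toFun A := LinearMap.mk₂'ₛₗ (starRingEnd ℂ) (RingHom.id ℂ)
    (fun u v => ⟪(u : H), L A v⟫_ℂ - ⟪K u, (A : H →L[ℂ] H) v⟫_ℂ - ⟪(u : H), (A : H →L[ℂ] H) (K v)⟫_ℂ)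
    (fun u u' v => by simp only [map_add, Submodule.coe_add, inner_add_left]; ring)
    (fun c u v => by
      simp only [map_smul, Submodule.coe_smul, inner_smul_left, smul_eq_mul]; ring)
    (fun u v v' => by simp only [map_add, Submodule.coe_add, inner_add_right]; ring)
    (fun c u v => by
      simp only [map_smul, Submodule.coe_smul, inner_smul_right, smul_eq_mul, RingHom.id_apply]
      ring)
  map_add' A B := by
    ext u v
    simp only [map_add, Submodule.coe_add, add_apply, inner_add_right, LinearMap.mk₂'ₛₗ_apply,
      LinearMap.add_apply]
    ring
  map_smul' c A := by
    ext u v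
    simp only [map_smul, Submodule.coe_smul, smul_apply, inner_smul_right, LinearMap.mk₂'ₛₗ_apply,
      LinearMap.smul_apply, smul_eq_mul, RingHom.id_apply]
    ring

omit [CompleteSpace H] in
theorem dissipationForm_apply {𝒜 : Submodule ℂ (H →L[ℂ] H)} (L : 𝒜 →ₗ[ℂ] (H →L[ℂ] H))
    {W : Submodule ℂ H} (K : W →ₗ[ℂ] H) (A : 𝒜) (u v : W) : dissipationForm L K A u v =
      ⟪(u : H), L A v⟫_ℂ - ⟪K u, (A : H →L[ℂ] H) v⟫_ℂ - ⟪(u : H), (A : H →L[ℂ] H) (K v)⟫_ℂ := rfl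

/-- The dissipation form is completely positive if `L` and `K` are weak limits of Hermitian
conditionally completely positive maps and the adjoints of the corresponding operators `G`. -/
theorem isUCompletelyPositive_dissipationForm {𝒜 : Submodule ℂ (H →L[ℂ] H)}
    {L : 𝒜 →ₗ[ℂ] (H →L[ℂ] H)} {W : Submodule ℂ H} {K : W →ₗ[ℂ] H} {ι : Type*} {l : Filter ι}
    [l.NeBot] {Λ : ι → (H →L[ℂ] H) →L[ℂ] (H →L[ℂ] H)} {G : ι → H →L[ℂ] H} {T : H →L[ℂ] H} {h : H}
    (hT : IsAssociateVector T h) (hΛ : ∀ᶠ i in l, IsConditionallyCompletelyPositive (Λ i))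
    (hstar : ∀ᶠ i in l, ∀ A, Λ i (star A) = star (Λ i A))
    (hG : ∀ᶠ i in l, ∀ x, G i x = Λ i (rankOne ℂ x (T h)) h - (2⁻¹ * ⟪h, Λ i T h⟫_ℂ) • x)
    (hL : ∀ (A : 𝒜) (x y : H), Tendsto (fun i => ⟪x, Λ i A y⟫_ℂ) l (𝓝 ⟪x, L A y⟫_ℂ))
    (hK : ∀ (u : W) (g : H), Tendsto (fun i => ⟪g, adjoint (G i) u⟫_ℂ) l (𝓝 ⟪g, K u⟫_ℂ)) :
    IsUCompletelyPositive (dissipationForm L K) := by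
  intro k A hA u
  have hlim : Tendsto (fun n => ∑ i, ∑ j, ⟪(u i : H), (Λ n (A i j) - G n * (A i j : H →L[ℂ] H) -
      (A i j : H →L[ℂ] H) * star (G n)) (u j)⟫_ℂ) l
      (𝓝 (∑ i, ∑ j, dissipationForm L K (A i j) (u i) (u j))) := by
    refine tendsto_finsetSum _ fun i _ => tendsto_finsetSum _ fun j _ => ?_
    simp only [dissipationForm_apply, sub_apply, inner_sub_right, mul_apply_eq_comp]
    refine ((hL _ _ _).sub ?_).sub ?_
    -- `G` moves to the left slot as `G⋆ u`, and conjugation brings it to the side where its weak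
    -- limit is known.
    · have h1 := (Complex.continuous_conj.tendsto _).comp
        (hK (u i) ((A i j : H →L[ℂ] H) (u j)))
      rw [inner_conj_symm] at h1
      refine h1.congr fun n => ?_
      rw [Function.comp_apply, inner_conj_symm, adjoint_inner_left]
    · have h2 := hK (u j) (adjoint (A i j : H →L[ℂ] H) (u i))
      simpa only [adjoint_inner_left, star_eq_adjoint] using h2
  refine ge_of_tendsto hlim ?_
  filter_upwards [hΛ, hstar, hG] with n h1 h2 h3
  exact h1.sum_sum_inner_nonneg_of_nonneg h2 hT h3 hA fun i => (u i : H)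

omit [CompleteSpace H] in
theorem isAssociateVector_rankOne_self {e : H} (he : ‖e‖ = 1) :
    IsAssociateVector (rankOne ℂ e e) e := by
  have he0 : e ≠ 0 := by
    rintro rfl
    simp at he
  refine ⟨rankOne_ne_zero he0 he0, 1, fun _ => e, fun _ => 1, ?_, fun _ => one_pos, ?_, ?_⟩
  · exact ⟨fun _ => he, fun i j hij => (hij (Subsingleton.elim i j)).elim⟩
  · simp
  · simp

/-- The operators `G` which the Yosida approximations of the generator and an associate vector
define: `G x = Λ (|x⟩⟨T h|) h - ⟨h, Λ(T) h⟩ x / 2`. -/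
def driftOperator (Λ : (H →L[ℂ] H) →L[ℂ] (H →L[ℂ] H)) (T : H →L[ℂ] H) (h : H) : H →L[ℂ] H :=
  (ContinuousLinearMap.apply ℂ H h).comp (Λ.comp ((rankOne ℂ).flip (T h))) -
    (2⁻¹ * ⟪h, Λ T h⟫_ℂ) • ContinuousLinearMap.id ℂ H

theorem driftOperator_apply (Λ : (H →L[ℂ] H) →L[ℂ] (H →L[ℂ] H)) (T : H →L[ℂ] H) (h x : H) :
    driftOperator Λ T h x = Λ (rankOne ℂ x (T h)) h - (2⁻¹ * ⟪h, Λ T h⟫_ℂ) • x := rfl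

theorem QuantumMarkovSemigroup.exists_generator_decomposition (S : QuantumMarkovSemigroup H)
    {T : H →L[ℂ] H} {h : H} (hT : IsAssociateVector T h) :
    ∃ (W : Submodule ℂ H) (φ : S.domain →ₗ[ℂ] (W →ₗ⋆[ℂ] W →ₗ[ℂ] ℂ)) (K : W →ₗ[ℂ] H),
      (∀ u : H, u ∈ W ↔ ∀ g : H, ∃ c : ℂ,
        Tendsto (fun ε => ⟪g, adjoint (driftOperator (S.yosida ε) T h) u⟫_ℂ) (𝓝[>] 0) (𝓝 c)) ∧
      (∀ (u : W) (g : H), Tendsto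
        (fun ε => ⟪g, adjoint (driftOperator (S.yosida ε) T h) u⟫_ℂ) (𝓝[>] 0) (𝓝 ⟪g, K u⟫_ℂ)) ∧
      IsUCompletelyPositive φ ∧
      ∀ (A : S.domain) (u v : W),
        ⟪(u : H), S.generator A v⟫_ℂ =
          φ A u v + ⟪K u, (A : H →L[ℂ] H) v⟫_ℂ + ⟪(u : H), (A : H →L[ℂ] H) (K v)⟫_ℂ := by
  obtain ⟨K, hK⟩ := exists_weakLimit_linearMap (𝓝[>] (0 : ℝ))
    fun ε => adjoint (driftOperator (S.yosida ε) T h)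
  refine ⟨_, dissipationForm S.generator K, K, fun u => Iff.rfl, hK, ?_, fun A u v => ?_⟩
  · exact isUCompletelyPositive_dissipationForm (l := 𝓝[>] (0 : ℝ)) hT
      (eventually_nhdsWithin_of_forall fun ε hε => S.isConditionallyCompletelyPositive_yosida hε)
      (.of_forall S.yosida_star) (.of_forall fun ε => driftOperator_apply _ T h)
      S.tendsto_inner_yosida hK
  · rw [dissipationForm_apply]
    ring

end

end

/-! ### The theorem -/

theorem theorem3p6 {H : Type*} [NormedAddCommGroup H] [InnerProductSpace ℂ H] [CompleteSpace H]
    (S : QuantumMarkovSemigroup H) :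
    (∃ (W : Submodule ℂ H) (φ : S.domain →ₗ[ℂ] (W →ₗ⋆[ℂ] W →ₗ[ℂ] ℂ)) (K : W →ₗ[ℂ] H),
      IsUCompletelyPositive φ ∧
      ∀ (A : S.domain) (u v : W),
        ⟪(u : H), S.generator A v⟫_ℂ =
          φ A u v + ⟪K u, (A : H →L[ℂ] H) v⟫_ℂ + ⟪(u : H), (A : H →L[ℂ] H) (K v)⟫_ℂ) ∧
    ∃ Lε : ℝ → (H →L[ℂ] H) →L[ℂ] (H →L[ℂ] H),
      (∀ ε, 0 < ε → IsYosidaApproximation S.generator ε (Lε ε)) ∧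
      ∀ (T : H →L[ℂ] H) (h : H), IsAssociateVector T h →
        ∃ G : ℝ → (H →L[ℂ] H),
          (∀ ε, 0 < ε → ∀ x : H, G ε x =
            Lε ε (InnerProductSpace.rankOne ℂ x (T h)) h - (2⁻¹ * ⟪h, Lε ε T h⟫_ℂ) • x) ∧
          ∃ (W : Submodule ℂ H) (φ : S.domain →ₗ[ℂ] (W →ₗ⋆[ℂ] W →ₗ[ℂ] ℂ)) (K : W →ₗ[ℂ] H),
            (∀ u : H, u ∈ W ↔ ∀ g : H, ∃ c : ℂ,
              Tendsto (fun ε => ⟪g, ContinuousLinearMap.adjoint (G ε) u⟫_ℂ) (𝓝[>] 0) (𝓝 c)) ∧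
            (∀ (u : W) (g : H), Tendsto (fun ε => ⟪g, ContinuousLinearMap.adjoint (G ε) u⟫_ℂ)
              (𝓝[>] 0) (𝓝 ⟪g, K u⟫_ℂ)) ∧
            IsUCompletelyPositive φ ∧
            ∀ (A : S.domain) (u v : W),
              ⟪(u : H), S.generator A v⟫_ℂ =
                φ A u v + ⟪K u, (A : H →L[ℂ] H) v⟫_ℂ + ⟪(u : H), (A : H →L[ℂ] H) (K v)⟫_ℂ := by
  have key := fun (T : H →L[ℂ] H) (h : H) (hT : IsAssociateVector T h) =>
    S.exists_generator_decomposition hT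
  refine ⟨?_, S.yosida, fun ε hε => S.isYosidaApproximation_yosida hε, fun T h hT =>
    ⟨fun ε => driftOperator (S.yosida ε) T h, fun ε _ x => driftOperator_apply _ T h x,
      key T h hT⟩⟩
  -- On the zero space no nonzero `T` exists; otherwise a unit vector `e` supplies `T = |e⟩⟨e|` with
  -- `h = e`.
  rcases subsingleton_or_nontrivial H with hH | hH
  · refine ⟨⊤, 0, 0, fun k A _ u => by simp, fun A u v => ?_⟩
    rw [Subsingleton.elim (u : H) 0]
    simp
  · obtain ⟨e, he⟩ := exists_norm_eq H zero_le_one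
    obtain ⟨W, φ, K, -, -, hφ, hL⟩ := key _ e (isAssociateVector_rankOne_self he)
    exact ⟨W, φ, K, hφ, hL⟩
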